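/- **Setting.** An instance of an online minimization problem with binary predictions is a triple $I=(x,\hat x,r)$, where $r=\langle r_1,\dots,r_n\rangle$ is a sequence of requests, $x\in\{0,1\}^n$ are the true bits (an encoding of a fixed optimal solution), and $\hat x\in\{0,1\}^n$ are predicted bits. A deterministic online algorithm must answer $r_i$ irrevocably, knowing only $r_1,\dots,r_i$ and $\hat x_1,\dots,\hat x_i$; $\mathrm{Alg}(I)$ is its cost and $\mathrm{Opt}(I)$ the minimum cost of a feasible solution. Let $\mu_0(I)=\sum_i x_i(1-\hat x_i)$ and $\mu_1(I)=\sum_i(1-x_i)\hat x_i$. For nonnegative real $\alpha,\beta,\gamma$, which may depend on the instance through $(x,\hat x)$ (for example, constants or functions of $n$), an algorithm is $(\alpha,\beta,\gamma)$-competitive with respect to $(\mu_0,\mu_1)$ if there is a constant $\kappa$ with $$\mathrm{Alg}(I)\le \alpha\,\mathrm{Opt}(I)+\beta\,\mu_0(I)+\gamma\,\mu_1(I)+\kappa\quad\text{for all instances } I .$$ A problem $Q$ is *as hard as* $P$ if, for all $\alpha,\beta,\gamma$, the existence of an $(\alpha,\beta,\gamma)$-competitive algorithm for $Q$ implies the existence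 of one for $P$. *Asymmetric string guessing* $\mathrm{ASG}_t$: $x$ is arbitrary, each request is only a prompt to guess a bit $y_i$, and the cost is $\sum_i\bigl(y_i+t\,x_i(1-y_i)\bigr)$. The class $\mathcal C^{\mu_0,\mu_1}_t$ consists of the online minimization problems $P$ such that $\mathrm{ASG}_t$ is as hard as $P$ with respect to $(\mu_0,\mu_1)$. *Paging with Discard Predictions* $\mathrm{Pag}_k$: the requests are pages from a finite universe $U$ with more than $k$ pages. The cache is initially empty and holds at most $k$ pages; a requested page must be in cache when served, pages may be evicted, and the cost is the number of faults (requests to pages not in cache). LFD is the offline algorithm that evicts only on a fault with a full cache, and then evicts the page whose next request is furthest in the future (ties, which occur only between pages never requested again, are broken by a fixed linear order on $U$). The true bit $x_i$ is $1$ if LFD evicts the page $r_i$ after serving $r_i$ and before it is requested again (or before the end of the sequence, if it is not requested again), and $0$ otherwise. *Flush-when-All-Zeros* (FwZ) is the paging algorithm that, on a fault with a full cache, evicts a page in cache whose latest request came with prediction $1$ (the smallest one), if there is one, and otherwise evicts all pages from cache. A *strict online reduction* from $P$ to $Q$ with respect to $(\mu_0,\mu_1)$ consists of maps $\rho_A$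 from algorithms for $Q$ to algorithms for $P$, and $\rho_T$ from pairs of an algorithm for $Q$ and an instance of $P$ to instances of $Q$, such that for some constant $a$, for all algorithms $\mathrm{Alg}$ for $Q$ and all instances $I$ of $P$, with $I'=\rho_T(\mathrm{Alg},I)$: $\rho_A(\mathrm{Alg})(I)\le\mathrm{Alg}(I')+a$, $\mathrm{Opt}_Q(I')\le\mathrm{Opt}_P(I)$, $\mu_0(I')\le\mu_0(I)$ and $\mu_1(I')\le\mu_1(I)$. **Theorem.** Let $t\ge1$ be an integer and let $U$ be a finite universe with more than $t$ pages. Then: 1. $\mathrm{Pag}_t\in\mathcal C^{\mu_0,\mu_1}_t$. 2. There is a strict online reduction from $\mathrm{Pag}_t$ to $\mathrm{ASG}_t$ with respect to $(\mu_0,\mu_1)$ whose map $\rho_A$ sends an algorithm $\mathrm{Alg}'$ for $\mathrm{ASG}_t$ to the paging algorithm that runs FwZ, using as the prediction for $r_i$ the guess that $\mathrm{Alg}'$ makes at its $i$-th prompt when it is given the predictions $\hat x_1,\dots,\hat x_i$. 3. For every instance $I$ of $\mathrm{Pag}_t$, $\mathrm{FwZ}(I)\le\mathrm{Opt}(I)+(t-1)\,\mu_0(I)+\mu_1(I)$.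 -/

import Mathlib

open scoped NNReal

/-! ### Online minimization problems with binary predictions -/

universe u v

/-- An online minimization problem with binary predictions. An instance is a triple `(x, xhat, r)`:
`r` is the request sequence, `x` the true bits (an encoding of a fixed optimal solution), and `xhat`
the predicted bits. A solution consists of one decision per request. -/
structure OnlineProblem where
  /-- requests -/
  Req : Type u
  /-- decisions -/
  Dec : Type u
  /-- `Encodes r x`: the bitstring `x` is an admissible string of true bits for the requests `r` -/
  Encodes : List Req → List Bool → Prop
  /-- `Feasible r y`: the decisions `y` form a feasible solution for the requests `r` -/
  Feasible : List Req → List Dec → Prop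
  /-- `solCost x r y`: the cost of the decisions `y` when the true bits are `x` -/
  solCost : List Bool → List Req → List Dec → ℕ

namespace OnlineProblem

/-- Instances `(x, xhat, r)` of a problem. -/
structure Instance (P : OnlineProblem.{u}) where
  x : List Bool
  xhat : List Bool
  r : List P.Req
  length_x : x.length = r.length
  length_xhat : xhat.length = r.length
  encodes : P.Encodes r x

/-- The sequence of decisions obtained when, at each step, a decision is computed from the requests
and predictions received so far (including the current ones). -/
def outputs {R D : Type*} (act : List (R × Bool) → D) (h : List (R × Bool)) : List D :=
  (List.range h.length).map fun i => act (h.take (i + 1))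

/-- Deterministic online algorithms with predictions: the decision for a request depends on the
requests and predictions received so far only. The solution must be feasible on every instance. -/
structure Algorithm (P : OnlineProblem.{u}) where
  act : List (P.Req × Bool) → P.Dec
  feasible : ∀ I : P.Instance, P.Feasible I.r (outputs act (I.r.zip I.xhat))

variable {P : OnlineProblem.{u}} {Q : OnlineProblem.{v}}

/-- The solution computed by an algorithm on an instance. -/
def Algorithm.solution (A : P.Algorithm) (I : P.Instance) : List P.Dec :=
  outputs A.act (I.r.zip I.xhat)

/-- The cost of an algorithm on an instance. -/
def Algorithm.cost (A : P.Algorithm) (I : P.Instance) : ℕ :=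
  P.solCost I.x I.r (A.solution I)

/-- The optimal (offline) cost: the minimum cost of a feasible solution. -/
noncomputable def Instance.opt (I : P.Instance) : ℕ :=
  sInf {c | ∃ y : List P.Dec, y.length = I.r.length ∧ P.Feasible I.r y ∧ P.solCost I.x I.r y = c}

/-- An error measure: a finite nonnegative quantity computed from the true and predicted bits. -/
abbrev ErrorMeasure := List Bool → List Bool → ℝ≥0

/-- `A` is `(α, β, γ)`-competitive with respect to `(η₀, η₁)`. The ratios may depend on the
instance, the additive constant `κ` may not. -/
def Competitive (η₀ η₁ : ErrorMeasure) (A : P.Algorithm) (α β γ : P.Instance → ℝ≥0) : Prop :=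
  ∃ κ : ℝ, ∀ I : P.Instance,
    (A.cost I : ℝ) ≤
      α I * (I.opt : ℝ) + β I * (η₀ I.x I.xhat : ℝ) + γ I * (η₁ I.x I.xhat : ℝ) + κ

/-- `Q` is as hard as `P` with respect to `(φ₀, φ₁)` and `(η₀, η₁)`: whenever `Q` has an
`(α, β, γ)`-competitive algorithm, so has `P`. So that the same ratios make sense for both problems,
they are functions of the data `(x, xhat)` common to the instances of all problems; this includes
constants and functions of the number of requests. -/
def AsHardAs (Q : OnlineProblem.{v}) (P : OnlineProblem.{u}) (φ₀ φ₁ η₀ η₁ : ErrorMeasure) : Prop :=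
  ∀ α β γ : List Bool → List Bool → ℝ≥0,
    (∃ A : Q.Algorithm, Competitive φ₀ φ₁ A
      (fun I => α I.x I.xhat) (fun I => β I.x I.xhat) (fun I => γ I.x I.xhat)) →
    ∃ B : P.Algorithm, Competitive η₀ η₁ B
      (fun I => α I.x I.xhat) (fun I => β I.x I.xhat) (fun I => γ I.x I.xhat)

/-- `(algMap, instMap)` is a strict online reduction from `P` to `Q`, where the errors are measured
by `(η₀, η₁)` for `P` and by `(φ₀, φ₁)` for `Q`. The constant `a` is the reduction term. -/
def IsStrictOnlineReduction (η₀ η₁ φ₀ φ₁ : ErrorMeasure)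
    (algMap : Q.Algorithm → P.Algorithm)
    (instMap : Q.Algorithm → P.Instance → Q.Instance) : Prop :=
  ∃ a : ℝ, ∀ (I : P.Instance) (A : Q.Algorithm),
    ((algMap A).cost I : ℝ) ≤ A.cost (instMap A I) + a ∧
    (instMap A I).opt ≤ I.opt ∧
    φ₀ (instMap A I).x (instMap A I).xhat ≤ η₀ I.x I.xhat ∧
    φ₁ (instMap A I).x (instMap A I).xhat ≤ η₁ I.x I.xhat

end OnlineProblem

open OnlineProblem

/-- The number of incorrect predictions of `0`. -/
def mu0 : ErrorMeasure := fun x xhat =>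
  (((x.zip xhat).map fun b => b.1.toNat * (1 - b.2.toNat)).sum : ℕ)

/-- The number of incorrect predictions of `1`. -/
def mu1 : ErrorMeasure := fun x xhat =>
  (((x.zip xhat).map fun b => (1 - b.1.toNat) * b.2.toNat).sum : ℕ)

/-! ### Asymmetric string guessing and the complexity classes -/

/-- Online `(1,t)`-asymmetric string guessing with unknown history and predictions: requests are
mere prompts, decisions are guesses `yᵢ`, and the cost is `∑ (yᵢ + t xᵢ (1 - yᵢ))`. -/
def ASG (t : ℕ) : OnlineProblem.{0} where
  Req := Unit
  Dec := Bool
  Encodes := fun _ _ => True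
  Feasible := fun _ _ => True
  solCost := fun x _ y =>
    ((x.zip y).map fun b => b.2.toNat + t * b.1.toNat * (1 - b.2.toNat)).sum

/-- The complexity class of the problems that are no harder than `ASG t`. -/
def ComplexityClass (t : ℕ) (η₀ η₁ : ErrorMeasure) : Set OnlineProblem.{u} :=
  {P | AsHardAs (ASG t) P η₀ η₁ η₀ η₁}

/-! ### Paging -/

section Paging

variable {U : Type u} [LinearOrder U]

/-- Serving a request for `p` with cache `C` while evicting the pages in `E`. -/
def serve (C : Finset U) (p : U) (E : Finset U) : Finset U := insert p (C \ E)

/-- Starting with cache `C`, serving the requests while evicting the given sets of pages (one set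
per request) never makes the cache hold more than `k` pages. -/
def PagingFeasible (k : ℕ) : Finset U → List U → List (Finset U) → Prop
  | _, [], [] => True
  | C, p :: r, E :: es => (serve C p E).card ≤ k ∧ PagingFeasible k (serve C p E) r es
  | _, _, _ => False

/-- The number of faults when serving requests, starting with cache `C`. -/
def faults : Finset U → List U → List (Finset U) → ℕ
  | C, p :: r, E :: es => (if p ∈ C then 0 else 1) + faults (serve C p E) r es
  | _, _, _ => 0

/-- The pages evicted by LFD when `p` is requested with cache `C` and `rest` are the requests still
to come: none if `p` is in cache or the cache is not full, and otherwise the page whose next request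
is furthest in the future. (`List.idxOf` is the length of the list for pages that are never
requested again; ties between such pages go to the smallest page.) -/
def lfdEvict (k : ℕ) (C : Finset U) (p : U) (rest : List U) : Finset U :=
  if p ∈ C ∨ C.card < k then ∅
  else C.filter fun q => ∀ q' ∈ C,
    rest.idxOf q' < rest.idxOf q ∨ (rest.idxOf q' = rest.idxOf q ∧ q ≤ q')

/-- The sets of pages evicted by LFD, request by request, starting with cache `C`. -/
def lfdRun (k : ℕ) : Finset U → List U → List (Finset U)
  | _, [] => []
  | C, p :: rest =>
    lfdEvict k C p rest :: lfdRun k (serve C p (lfdEvict k C p rest)) rest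

/-- Given the coming requests and the sets of pages evicted at them: is `p` evicted before it is
requested again (or before the end, if it is not requested again)? -/
def evictedBeforeNext (p : U) : List (U × Finset U) → Bool
  | [] => false
  | (q, E) :: l => if p ∈ E then true else if q = p then false else evictedBeforeNext p l

/-- For each request: is its page evicted before it is requested again? -/
def discardBits : List (U × Finset U) → List Bool
  | [] => []
  | (p, _) :: l => evictedBeforeNext p l :: discardBits l

/-- The true bits of a request sequence: `1` if LFD (with initially empty cache) evicts the page
before it is requested again, and `0` if LFD keeps it. -/
def lfdBits (k : ℕ) (r : List U) : List Bool := discardBits (r.zip (lfdRun k ∅ r))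

variable (U) in
/-- Paging with discard predictions, with universe `U`, cache size `k` and initially empty cache.
The decision for a request is which pages to evict; the cost is the number of faults. -/
def Paging (k : ℕ) : OnlineProblem.{u} where
  Req := U
  Dec := Finset U
  Encodes := fun r x => x = lfdBits k r
  Feasible := fun r es => PagingFeasible k ∅ r es
  solCost := fun _ r es => faults ∅ r es

/-! ### Flush-when-All-Zeros -/

/-- The pages evicted by Flush-when-All-Zeros when `p` is requested with cache `C`, where `bit q` is
the prediction that came with the latest request for `q`: none if `p` is in cache or the cache is
not full; otherwise a page in cache with bit `1` (the smallest one), if there is one; and the whole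
cache if there is none. -/
def fwzEvict (k : ℕ) (C : Finset U) (bit : U → Bool) (p : U) : Finset U :=
  if p ∈ C ∨ C.card < k then ∅
  else if ∃ q ∈ C, bit q = true then
    C.filter fun q => bit q = true ∧ ∀ q' ∈ C, bit q' = true → q ≤ q'
  else C

/-- The sets of pages evicted by Flush-when-All-Zeros on a sequence of requests and predictions. -/
def fwzRun (k : ℕ) : Finset U → (U → Bool) → List (U × Bool) → List (Finset U)
  | _, _, [] => []
  | C, bit, (p, b) :: h =>
    fwzEvict k C bit p ::
      fwzRun k (serve C p (fwzEvict k C bit p)) (Function.update bit p b) h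

/-- The decision of Flush-when-All-Zeros for the latest request of a history. -/
def fwzAct (k : ℕ) (h : List (U × Bool)) : Finset U :=
  (fwzRun k ∅ (fun _ => false) h).getLastD ∅

/-- Replace the predictions in a paging history by the guesses made by the string guessing strategy
`guess` when it is given these predictions. -/
def withGuesses (guess : List (Unit × Bool) → Bool) (h : List (U × Bool)) : List (U × Bool) :=
  (h.map Prod.fst).zip (outputs guess (h.map fun q => ((), q.2)))

theorem fwzEvict_subset (k : ℕ) (C : Finset U) (bit : U → Bool) (p : U) :
    fwzEvict k C bit p ⊆ C := by
  unfold fwzEvict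
  split_ifs
  · exact Finset.empty_subset _
  · exact Finset.filter_subset _ _
  · exact Finset.Subset.refl _

theorem fwzEvict_nonempty {k : ℕ} {C : Finset U} {p : U} (bit : U → Bool) (hk : 1 ≤ k)
    (h : ¬ (p ∈ C ∨ C.card < k)) : (fwzEvict k C bit p).Nonempty := by
  unfold fwzEvict
  rw [if_neg h]
  push Not at h
  split_ifs with h1
  · obtain ⟨q, hq, hb⟩ := h1
    have hne : (C.filter fun q => bit q = true).Nonempty := ⟨q, by simp [hq, hb]⟩
    refine ⟨(C.filter fun q => bit q = true).min' hne, ?_⟩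
    have hm := Finset.min'_mem _ hne
    rw [Finset.mem_filter] at hm ⊢
    exact ⟨hm.1, hm.2, fun q' h1 h2 => Finset.min'_le _ _ (by simp [h1, h2])⟩
  · exact Finset.card_pos.mp (by omega)

theorem card_serve_fwzEvict {k : ℕ} {C : Finset U} (bit : U → Bool) (p : U) (hk : 1 ≤ k)
    (hC : C.card ≤ k) : (serve C p (fwzEvict k C bit p)).card ≤ k := by
  unfold serve
  by_cases h : p ∈ C ∨ C.card < k
  · have hE : fwzEvict k C bit p = ∅ := by unfold fwzEvict; rw [if_pos h]
    rw [hE, Finset.sdiff_empty]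
    rcases h with h | h
    · rwa [Finset.insert_eq_of_mem h]
    · exact (Finset.card_insert_le _ _).trans h
  · have h1 := Finset.card_pos.mpr (fwzEvict_nonempty bit hk h)
    have h2 := Finset.card_sdiff_add_card_eq_card (fwzEvict_subset k C bit p)
    have h3 := Finset.card_insert_le p (C \ fwzEvict k C bit p)
    omega

theorem fwzRun_feasible {k : ℕ} (hk : 1 ≤ k) (h : List (U × Bool)) (C : Finset U)
    (bit : U → Bool) (hC : C.card ≤ k) :
    PagingFeasible k C (h.map Prod.fst) (fwzRun k C bit h) := by
  induction h generalizing C bit with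
  | nil => simp [fwzRun, PagingFeasible]
  | cons a h ih =>
    obtain ⟨p, b⟩ := a
    have h1 := card_serve_fwzEvict bit p hk hC
    exact ⟨h1, ih _ _ h1⟩

theorem length_fwzRun (k : ℕ) (h : List (U × Bool)) (C : Finset U) (bit : U → Bool) :
    (fwzRun k C bit h).length = h.length := by
  induction h generalizing C bit with
  | nil => rfl
  | cons a h ih => simp [fwzRun, ih]

theorem fwzRun_take (k n : ℕ) (h : List (U × Bool)) (C : Finset U) (bit : U → Bool) :
    fwzRun k C bit (h.take n) = (fwzRun k C bit h).take n := by
  induction h generalizing C bit n with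
  | nil => simp [fwzRun]
  | cons a h ih =>
    cases n with
    | zero => simp [fwzRun]
    | succ n => simp [fwzRun, ih]

theorem length_outputs {R D : Type*} (act : List (R × Bool) → D) (h : List (R × Bool)) :
    (outputs act h).length = h.length := by
  simp [outputs]

theorem outputs_take {R D : Type*} (act : List (R × Bool) → D) (h : List (R × Bool)) (n : ℕ) :
    outputs act (h.take n) = (outputs act h).take n := by
  apply List.ext_getElem
  · simp [outputs]
  · intro i h1 h2
    have h3 : i < n := by simp [outputs] at h1; omega
    simp only [outputs, List.getElem_map, List.getElem_range, List.getElem_take, List.take_take]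
    rw [min_eq_left (by omega)]

theorem outputs_getLastD {R D : Type*} (F : List (R × Bool) → List D) (d : D)
    (hlen : ∀ h, (F h).length = h.length) (htake : ∀ h n, F (h.take n) = (F h).take n)
    (h : List (R × Bool)) : outputs (fun l => (F l).getLastD d) h = F h := by
  apply List.ext_getElem
  · simp [outputs, hlen]
  · intro i h1 h2
    have h3 : i < h.length := by rw [← hlen]; exact h2
    simp only [outputs, List.getElem_map, List.getElem_range, htake]
    rw [List.getLastD_eq_getLast?, List.getLast?_eq_getElem?]
    have h4 : (List.take (i + 1) (F h)).length - 1 = i := by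
      rw [List.length_take, hlen]; omega
    rw [h4, List.getElem?_take, if_pos (by omega), List.getElem?_eq_getElem h2]
    rfl

theorem outputs_fwzAct (k : ℕ) (h : List (U × Bool)) :
    outputs (fwzAct k) h = fwzRun k ∅ (fun _ => false) h :=
  outputs_getLastD (fwzRun k ∅ fun _ => false) ∅ (fun h => length_fwzRun k h _ _)
    (fun h n => fwzRun_take k n h _ _) h

theorem length_withGuesses {V : Type*} (g : List (Unit × Bool) → Bool) (h : List (V × Bool)) :
    (withGuesses g h).length = h.length := by
  simp [withGuesses, length_outputs]

theorem withGuesses_take {V : Type*} (g : List (Unit × Bool) → Bool) (h : List (V × Bool)) (n : ℕ) :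
    withGuesses g (h.take n) = (withGuesses g h).take n := by
  unfold withGuesses
  simp only [List.map_take, outputs_take, List.zip, List.take_zipWith]

theorem map_fst_withGuesses {V : Type*} (g : List (Unit × Bool) → Bool) (h : List (V × Bool)) :
    (withGuesses g h).map Prod.fst = h.map Prod.fst :=
  List.map_fst_zip (by simp [length_outputs])

theorem outputs_fwzAct_withGuesses (k : ℕ) (g : List (Unit × Bool) → Bool)
    (h : List (U × Bool)) :
    outputs (fun l => fwzAct k (withGuesses g l)) h =
      fwzRun k ∅ (fun _ => false) (withGuesses g h) :=
  outputs_getLastD (fun l => fwzRun k ∅ (fun _ => false) (withGuesses g l)) ∅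
    (fun h => (length_fwzRun k _ _ _).trans (length_withGuesses g h))
    (fun h n => by rw [withGuesses_take, fwzRun_take]) h

theorem fwzAct_feasible {k : ℕ} (hk : 1 ≤ k) (r : List U) (b : List Bool)
    (hb : b.length = r.length) :
    PagingFeasible k ∅ r (outputs (fwzAct k) (r.zip b)) := by
  have h1 := fwzRun_feasible hk (r.zip b) ∅ (fun _ => false) (by simp)
  rwa [List.map_fst_zip hb.ge, ← outputs_fwzAct] at h1

theorem fwzAct_withGuesses_feasible {k : ℕ} (hk : 1 ≤ k) (g : List (Unit × Bool) → Bool)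
    (r : List U) (b : List Bool) (hb : b.length = r.length) :
    PagingFeasible k ∅ r (outputs (fun h => fwzAct k (withGuesses g h)) (r.zip b)) := by
  have h1 := fwzRun_feasible hk (withGuesses g (r.zip b)) ∅ (fun _ => false) (by simp)
  rwa [map_fst_withGuesses, List.map_fst_zip hb.ge, ← outputs_fwzAct_withGuesses] at h1

variable (U) in
/-- The paging algorithm Flush-when-All-Zeros. -/
def FwZ (k : ℕ) (hk : 1 ≤ k) : (Paging U k).Algorithm where
  act := fwzAct (U := U) k
  feasible := fun I => fwzAct_feasible (U := U) hk I.r I.xhat I.length_xhat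

variable (U) in
/-- The paging algorithm that runs Flush-when-All-Zeros with the guesses of an algorithm for `ASG t`
in place of the predictions. -/
def fwzWithGuesses (t : ℕ) (ht : 1 ≤ t) (A : (ASG t).Algorithm) : (Paging U t).Algorithm where
  act := fun h : List (U × Bool) => fwzAct t (withGuesses A.act h)
  feasible := fun I => fwzAct_withGuesses_feasible (U := U) ht A.act I.r I.xhat I.length_xhat

end Paging

/-! The true bits `x` of a request sequence mark the requests whose page LFD evicts before its next
request, so `∑ xᵢ` is the number of evictions of LFD, and `∑ xᵢ + |final LFD cache|` is its number
of faults (`sum_discardBits_lfdRun_add_card`). Three further facts carry the theorem.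

* LFD is optimal (`faults_lfdRun_le`). Compare its cache `C` with the cache `D` of another solution
  by counting, for each `τ`, the pages whose next request is among the coming `τ` ones. If `D` is
  ahead of `C` by at most `m` for every `τ`, then LFD has at most `m` more faults in the future. The
  bound survives an eviction by LFD because it removes the page requested last: if that page is
  counted by `τ`, then so was the whole full cache.
* Run with any bits `y`, FwZ has at most `∑ (yᵢ + t xᵢ (1 - yᵢ)) + |final FwZ cache|` faults
  (`faults_fwzRun_add_card_le`). Charge the eviction of a page with bit `1` to its latest request.
  When FwZ flushes, the `t` pages in its cache and the requested page cannot all survive in the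
  cache of LFD, so that one of the flushed pages has true bit `1` and bit `0`; it pays for all `t`.
* The final cache of FwZ is no larger than that of LFD (`card_cacheAfter_fwzRun_le`), as LFD drops
  pages only when its cache is full.

Since `∑ (yᵢ + t xᵢ (1 - yᵢ)) = ∑ xᵢ + (t - 1) μ₀ + μ₁`, the bound on FwZ follows. For the
reduction, keep `x` and `xhat` and replace the requests by prompts: the optimum for string guessing
is at most `∑ xᵢ`, and the final cache contributes the additive constant `t`. As the reduction
preserves `x` and `xhat`, it transfers competitiveness. -/

/-! ### Costs in string guessing -/

/-- The cost of the guesses `y` in `ASG t` when the true bits are `x`. -/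
def asgCost (t : ℕ) (x y : List Bool) : ℕ :=
  ((x.zip y).map fun b => b.2.toNat + t * b.1.toNat * (1 - b.2.toNat)).sum

theorem asgCost_cons (t : ℕ) (a b : Bool) (x y : List Bool) :
    asgCost t (a :: x) (b :: y) = b.toNat + t * a.toNat * (1 - b.toNat) + asgCost t x y := by
  simp [asgCost]

theorem asgCost_self (t : ℕ) (x : List Bool) : asgCost t x x = (x.map Bool.toNat).sum := by
  induction x with
  | nil => rfl
  | cons a x ih =>
    rw [asgCost_cons, ih]
    cases a <;> simp

theorem asgCost_eq (t : ℕ) (x y : List Bool) (h : x.length = y.length) :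
    (asgCost t x y : ℝ) =
      ((x.map Bool.toNat).sum : ℕ) + ((t : ℝ) - 1) * (mu0 x y : ℝ) + (mu1 x y : ℝ) := by
  induction x generalizing y with
  | nil => simp [asgCost, mu0, mu1]
  | cons a x ih =>
    cases y with
    | nil => simp at h
    | cons b y =>
      have h1 := ih y (by simpa using h)
      rw [asgCost_cons, Nat.cast_add, h1]
      cases a <;> cases b <;> simp [mu0, mu1] <;> ring

section Caches

variable {U : Type*} [LinearOrder U]

/-! ### Caches and evictions -/

/-- The cache after serving the requests, starting with cache `C`. -/
def cacheAfter : Finset U → List U → List (Finset U) → Finset U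
  | C, p :: r, E :: es => cacheAfter (serve C p E) r es
  | C, _, _ => C

theorem mem_serve_self (C : Finset U) (p : U) (E : Finset U) : p ∈ serve C p E := by
  simp [serve]

theorem mem_serve_of_ne {C E : Finset U} {p q : U} (h : q ≠ p) :
    q ∈ serve C p E ↔ q ∈ C ∧ q ∉ E := by
  simp [serve, h]

theorem serve_eq_insert_erase (C : Finset U) (p : U) (E : Finset U) :
    serve C p E = insert p ((C \ E).erase p) := by
  ext q
  by_cases h : q = p <;> simp [serve, h]

theorem card_serve_of_mem_imp {C E : Finset U} {p : U} (h : p ∈ C → E = ∅) :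
    (serve C p E).card = (C \ E).card + if p ∈ C then 0 else 1 := by
  unfold serve
  split_ifs with hp
  · rw [h hp, Finset.sdiff_empty, Finset.insert_eq_of_mem hp, add_zero]
  · rw [Finset.card_insert_of_notMem (by simp [hp])]

theorem lfdEvict_subset (k : ℕ) (C : Finset U) (p : U) (rest : List U) :
    lfdEvict k C p rest ⊆ C := by
  unfold lfdEvict
  split_ifs
  · exact Finset.empty_subset _
  · exact Finset.filter_subset _ _

theorem lfdEvict_of_mem_or_lt {k : ℕ} {C : Finset U} {p : U} (rest : List U)
    (h : p ∈ C ∨ C.card < k) : lfdEvict k C p rest = ∅ := by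
  rw [lfdEvict, if_pos h]

/-- On a fault with a full cache, LFD evicts a single page, requested last among those in cache. -/
theorem exists_lfdEvict_eq_singleton {k : ℕ} {C : Finset U} {p : U} (rest : List U) (hk : 1 ≤ k)
    (h : ¬ (p ∈ C ∨ C.card < k)) :
    ∃ q ∈ C, lfdEvict k C p rest = {q} ∧ ∀ q' ∈ C, rest.idxOf q' ≤ rest.idxOf q := by
  have hne : C.Nonempty := Finset.card_pos.mp (by push Not at h; omega)
  obtain ⟨m, hm, hmax⟩ := Finset.exists_max_image C (fun q => rest.idxOf q) hne
  have hne' : (C.filter fun q => rest.idxOf q = rest.idxOf m).Nonempty := ⟨m, by simp [hm]⟩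
  have hq := Finset.min'_mem _ hne'
  have hmin := fun q' hq' => Finset.min'_le (C.filter fun q => rest.idxOf q = rest.idxOf m) q' hq'
  obtain ⟨q, hqdef⟩ : ∃ q, q = Finset.min' _ hne' := ⟨_, rfl⟩
  rw [← hqdef] at hq
  replace hmin : ∀ q' ∈ C.filter (fun q => rest.idxOf q = rest.idxOf m), q ≤ q' :=
    fun q' hq' => hqdef.trans_le (hmin q' hq')
  rw [Finset.mem_filter] at hq
  have hle : ∀ q' ∈ C, rest.idxOf q' ≤ rest.idxOf q := fun q' h' => hq.2 ▸ hmax q' h'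
  refine ⟨q, hq.1, ?_, hle⟩
  rw [lfdEvict, if_neg h]
  ext z
  simp only [Finset.mem_filter, Finset.mem_singleton]
  constructor
  · rintro ⟨hz, hz'⟩
    have h1 := hle z hz
    rcases hz' q hq.1 with h2 | ⟨h2, h3⟩
    · omega
    · exact le_antisymm h3 (hmin z (by simp [hz, ← h2, hq.2]))
  · rintro rfl
    refine ⟨hq.1, fun q' h' => ?_⟩
    rcases (hle q' h').lt_or_eq with h2 | h2
    · exact Or.inl h2
    · exact Or.inr ⟨h2, hmin q' (by simp [h', h2, hq.2])⟩

theorem card_serve_lfdEvict {k : ℕ} {C : Finset U} (p : U) (rest : List U) (hk : 1 ≤ k)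
    (hC : C.card ≤ k) : (serve C p (lfdEvict k C p rest)).card ≤ k := by
  by_cases h : p ∈ C ∨ C.card < k
  · rw [lfdEvict_of_mem_or_lt rest h, serve, Finset.sdiff_empty]
    rcases h with h | h
    · rwa [Finset.insert_eq_of_mem h]
    · exact (Finset.card_insert_le _ _).trans h
  · obtain ⟨q, hq, hE, -⟩ := exists_lfdEvict_eq_singleton rest hk h
    have h1 := Finset.card_insert_le p (C \ {q})
    have h2 := Finset.card_sdiff_add_card_eq_card (Finset.singleton_subset_iff.mpr hq)
    rw [Finset.card_singleton] at h2
    rw [hE, serve]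
    omega

theorem length_lfdRun (k : ℕ) (r : List U) (C : Finset U) : (lfdRun k C r).length = r.length := by
  induction r generalizing C with
  | nil => rfl
  | cons p r ih => simp [lfdRun, ih]

theorem lfdRun_feasible {k : ℕ} (hk : 1 ≤ k) (r : List U) (C : Finset U) (hC : C.card ≤ k) :
    PagingFeasible k C r (lfdRun k C r) := by
  induction r generalizing C with
  | nil => simp [lfdRun, PagingFeasible]
  | cons p r ih =>
    have h1 := card_serve_lfdEvict p r hk hC
    exact ⟨h1, ih _ h1⟩

/-! ### Optimality of LFD -/

/-- The number of pages in `C` that occur among the first `τ` requests of `r`, for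
`τ ≤ r.length`. Larger `τ` count all pages in `C`. -/
def cachedBefore (C : Finset U) (r : List U) (τ : ℕ) : ℕ :=
  (C.filter fun q => r.idxOf q < τ).card

theorem cachedBefore_mono {C D : Finset U} (h : C ⊆ D) (r : List U) (τ : ℕ) :
    cachedBefore C r τ ≤ cachedBefore D r τ :=
  Finset.card_le_card (Finset.filter_subset_filter _ h)

theorem cachedBefore_le_card (C : Finset U) (r : List U) (τ : ℕ) :
    cachedBefore C r τ ≤ C.card :=
  Finset.card_filter_le _ _

theorem cachedBefore_insert {C : Finset U} {p : U} (hp : p ∉ C) (r : List U) (τ : ℕ) :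
    cachedBefore (insert p C) r τ = cachedBefore C r τ + if r.idxOf p < τ then 1 else 0 := by
  unfold cachedBefore
  rw [Finset.filter_insert]
  split_ifs
  · rw [Finset.card_insert_of_notMem (by simp [hp])]
  · rfl

theorem cachedBefore_cons_succ (C : Finset U) (p : U) (r : List U) (τ : ℕ) :
    cachedBefore C (p :: r) (τ + 1) =
      cachedBefore (C.erase p) r τ + if p ∈ C then 1 else 0 := by
  have h1 : cachedBefore (C.erase p) (p :: r) (τ + 1) = cachedBefore (C.erase p) r τ := by
    unfold cachedBefore
    congr 1
    refine Finset.filter_congr fun q hq => ?_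
    rw [List.idxOf_cons_ne _ (Finset.ne_of_mem_erase hq).symm]
    omega
  split_ifs with hp
  · conv_lhs => rw [← Finset.insert_erase hp]
    rw [cachedBefore_insert (by simp), h1]
    simp
  · rw [Finset.erase_eq_of_notMem hp] at h1 ⊢
    exact h1

theorem cachedBefore_zero (C : Finset U) (r : List U) : cachedBefore C r 0 = 0 := by
  simp [cachedBefore]

/-- If the cache `D` is ahead of the cache `C` of LFD by at most `m` pages, whatever the number of
coming requests taken into account, then LFD has at most `m` faults more than any solution that
starts with `D`. -/
theorem faults_lfdRun_le_add {k : ℕ} (hk : 1 ≤ k) (r : List U) (es : List (Finset U))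
    (C D : Finset U) (m : ℕ) (hC : C.card ≤ k) (hD : PagingFeasible k D r es)
    (hm : ∀ τ, cachedBefore D r τ ≤ cachedBefore C r τ + m) :
    faults C r (lfdRun k C r) ≤ faults D r es + m := by
  induction r generalizing es C D m with
  | nil => simp [faults]
  | cons p r ih =>
    cases es with
    | nil => exact hD.elim
    | cons E es =>
      obtain ⟨hD1, hD2⟩ := hD
      have hm' : ∀ τ, cachedBefore (D.erase p) r τ + (if p ∈ D then 1 else 0) ≤
          cachedBefore (C.erase p) r τ + (if p ∈ C then 1 else 0) + m := fun τ => by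
        have := hm (τ + 1)
        rwa [cachedBefore_cons_succ, cachedBefore_cons_succ] at this
      have h0 := hm' 0
      rw [cachedBefore_zero, cachedBefore_zero] at h0
      set F := lfdEvict k C p r with hF
      -- The new lead `m'` balances the faults of both solutions on `p`; it is nonnegative by `h0`.
      obtain ⟨m', hm'eq⟩ : ∃ m', m' + (if p ∈ C then 0 else 1) = m + (if p ∈ D then 0 else 1) :=
        ⟨m + (if p ∈ D then 0 else 1) - (if p ∈ C then 0 else 1), by split_ifs at h0 ⊢ <;> omega⟩
      have key : ∀ τ, cachedBefore (serve D p E) r τ ≤ cachedBefore (serve C p F) r τ + m' := by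
        intro τ
        have hsD := serve_eq_insert_erase D p E
        have hsC := serve_eq_insert_erase C p F
        rw [hsD, hsC, cachedBefore_insert (by simp), cachedBefore_insert (by simp)]
        have hDcard : ((D \ E).erase p).card + 1 ≤ k := by
          rw [hsD, Finset.card_insert_of_notMem (by simp)] at hD1
          exact hD1
        have hD3 := cachedBefore_le_card ((D \ E).erase p) r τ
        have hD4 : cachedBefore ((D \ E).erase p) r τ ≤ cachedBefore (D.erase p) r τ :=
          cachedBefore_mono (Finset.erase_subset_erase _ Finset.sdiff_subset) r τ
        have h1 := hm' τ
        suffices cachedBefore ((D \ E).erase p) r τ ≤ cachedBefore ((C \ F).erase p) r τ + m' by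
          omega
        by_cases h : p ∈ C ∨ C.card < k
        · rw [hF, lfdEvict_of_mem_or_lt r h, Finset.sdiff_empty]
          split_ifs at h1 hm'eq <;> omega
        · obtain ⟨q, hq, hE, hmax⟩ := exists_lfdEvict_eq_singleton r hk h
          push Not at h
          rw [hF, hE, Finset.sdiff_singleton_eq_erase,
            Finset.erase_eq_of_notMem fun h' => h.1 (Finset.mem_of_mem_erase h')]
          rw [Finset.erase_eq_of_notMem h.1] at h1
          have h2 := cachedBefore_insert (Finset.notMem_erase q C) r τ
          rw [Finset.insert_erase hq] at h2
          by_cases hqτ : r.idxOf q < τ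
          · -- The evicted page is counted, hence so is every page of the full cache.
            have h3 : cachedBefore C r τ = C.card := by
              unfold cachedBefore
              rw [Finset.filter_true_of_mem fun q' h' => (hmax q' h').trans_lt hqτ]
            rw [if_pos hqτ] at h2
            split_ifs at h0 hm'eq <;> omega
          · rw [if_neg hqτ] at h2
            split_ifs at h1 hm'eq <;> omega
      have h2 := ih es _ _ m' (card_serve_lfdEvict p r hk hC) hD2 key
      simp only [lfdRun, faults]
      omega

theorem faults_lfdRun_le {k : ℕ} (hk : 1 ≤ k) (r : List U) (es : List (Finset U))
    (h : PagingFeasible k ∅ r es) : faults ∅ r (lfdRun k ∅ r) ≤ faults ∅ r es :=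
  faults_lfdRun_le_add hk r es ∅ ∅ 0 (by simp) h (by simp)

/-! ### The true bits count the evictions of LFD -/

/-- Every fault of LFD loads a page that is evicted later on or stays in cache until the end; the
pages of the initial cache `C` that are evicted before their next request have no bit of their
own. -/
theorem sum_discardBits_lfdRun_add_card (k : ℕ) (r : List U) (C : Finset U) :
    ((discardBits (r.zip (lfdRun k C r))).map Bool.toNat).sum +
        (C.filter fun q => evictedBeforeNext q (r.zip (lfdRun k C r)) = true).card +
        (cacheAfter C r (lfdRun k C r)).card =
      faults C r (lfdRun k C r) + C.card := by
  induction r generalizing C with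
  | nil => simp [lfdRun, discardBits, evictedBeforeNext, cacheAfter, faults]
  | cons p r ih =>
    have hsub := lfdEvict_subset k C p r
    have hemp : p ∈ C → lfdEvict k C p r = ∅ := fun h => lfdEvict_of_mem_or_lt r (Or.inl h)
    have h1 := ih (serve C p (lfdEvict k C p r))
    rw [lfdRun, List.zip_cons_cons]
    simp only [discardBits, List.map_cons, List.sum_cons, cacheAfter, faults]
    set E := lfdEvict k C p r
    set l := r.zip (lfdRun k (serve C p E) r)
    have hcard := Finset.card_sdiff_add_card_eq_card hsub
    set G := ((C \ E).erase p).filter fun q => evictedBeforeNext q l = true with hG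
    have hpG : p ∉ G := by simp [hG]
    have h2 : (C.filter fun q => evictedBeforeNext q ((p, E) :: l) = true) = E ∪ G := by
      ext q
      have := @hsub q
      by_cases hqE : q ∈ E
      · simp [evictedBeforeNext, hqE, this]
      · by_cases hqp : q = p
        · subst hqp
          simp [evictedBeforeNext, hqE, hG]
        · simp [evictedBeforeNext, hqE, hqp, hG, Ne.symm hqp]
    have hdisj : Disjoint E G := by
      rw [Finset.disjoint_left]
      intro q hq
      simp [hG, hq]
    have h3 : ((serve C p E).filter fun q => evictedBeforeNext q l = true).card =
        (evictedBeforeNext p l).toNat + G.card := by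
      rw [serve_eq_insert_erase, Finset.filter_insert, ← hG]
      split_ifs with h
      · rw [Finset.card_insert_of_notMem hpG, h, Bool.toNat_true, add_comm]
      · simp [h]
    have h4 : (serve C p E).card = (C \ E).card + if p ∈ C then 0 else 1 :=
      card_serve_of_mem_imp hemp
    rw [h2, Finset.card_union_of_disjoint hdisj]
    omega

/-! ### The faults of Flush-when-All-Zeros -/

/-- What a page `q` in the cache of FwZ can pay on its eviction, given the bit of its latest
request, the cache `C` of a reference solution and the coming requests `l` with its evictions:
`1` if its bit is `1`, and `k` if its bit is `0`, but the reference solution has evicted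
`q` since its latest request or will do so before the next one. -/
def pageCharge (k : ℕ) (C : Finset U) (bit : U → Bool) (l : List (U × Finset U)) (q : U) : ℕ :=
  if bit q = true then 1 else if q ∉ C ∨ evictedBeforeNext q l = true then k else 0

/-- Serving a request leaves the charges of the other pages unchanged. -/
theorem pageCharge_serve_of_ne (k : ℕ) (C E : Finset U) (bit : U → Bool)
    (l : List (U × Finset U)) {p q : U} (b : Bool) (h : q ≠ p) :
    pageCharge k (serve C p E) (Function.update bit p b) l q =
      pageCharge k C bit ((p, E) :: l) q := by
  unfold pageCharge
  by_cases h1 : q ∈ E <;> simp [evictedBeforeNext, h1, h, Ne.symm h, mem_serve_of_ne h]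

/-- The charge of a page that has just been requested is the cost of its bit in string guessing. -/
theorem pageCharge_serve_self (k : ℕ) (C E : Finset U) (bit : U → Bool)
    (l : List (U × Finset U)) (p : U) (b : Bool) :
    pageCharge k (serve C p E) (Function.update bit p b) l p =
      b.toNat + k * (evictedBeforeNext p l).toNat * (1 - b.toNat) := by
  unfold pageCharge
  rw [Function.update_self]
  cases b <;> cases h : evictedBeforeNext p l <;> simp [mem_serve_self]

/-- The pages evicted by FwZ pay for their eviction. -/
theorem card_fwzEvict_le_sum_pageCharge {k : ℕ} {C D E : Finset U} {p : U} (bit : U → Bool)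
    (l : List (U × Finset U)) (hC : C.card ≤ k) (hD : (serve D p E).card ≤ k) :
    (fwzEvict k C bit p).card ≤
      ∑ q ∈ fwzEvict k C bit p, pageCharge k D bit ((p, E) :: l) q := by
  unfold fwzEvict
  split_ifs with h h1
  · simp
  · rw [Finset.card_eq_sum_ones]
    refine Finset.sum_le_sum fun q hq => ?_
    simp [pageCharge, (Finset.mem_filter.mp hq).2.1]
  · push Not at h h1
    -- Otherwise the reference solution would keep all pages of `C` together with `p`.
    obtain ⟨q, hq, hq'⟩ : ∃ q ∈ C, q ∉ D ∨ q ∈ E := by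
      by_contra! hcon
      have hsub : insert p C ⊆ serve D p E := by
        unfold serve
        refine Finset.insert_subset_insert p fun q hq => ?_
        simpa using hcon q hq
      have h2 := Finset.card_le_card hsub
      rw [Finset.card_insert_of_notMem h.1] at h2
      omega
    have h2 : pageCharge k D bit ((p, E) :: l) q = k := by
      have h3 : q ∉ D ∨ evictedBeforeNext q ((p, E) :: l) = true :=
        hq'.imp_right fun h3 => by simp [evictedBeforeNext, h3]
      rw [pageCharge, if_neg (h1 q hq), if_pos h3]
    calc C.card ≤ pageCharge k D bit ((p, E) :: l) q := hC.trans h2.ge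
      _ ≤ _ := Finset.single_le_sum (f := pageCharge k D bit ((p, E) :: l))
        (fun _ _ => Nat.zero_le _) hq

/-- The faults of FwZ are paid for by the string guessing cost of its bits, where the true bits are
those of an arbitrary feasible reference solution `es`. -/
theorem faults_fwzRun_add_card_le {k : ℕ} (hk : 1 ≤ k) (h : List (U × Bool)) (C D : Finset U)
    (bit : U → Bool) (es : List (Finset U)) (hC : C.card ≤ k)
    (hD : PagingFeasible k D (h.map Prod.fst) es) :
    faults C (h.map Prod.fst) (fwzRun k C bit h) + C.card ≤
      asgCost k (discardBits ((h.map Prod.fst).zip es)) (h.map Prod.snd) +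
        ∑ q ∈ C, pageCharge k D bit ((h.map Prod.fst).zip es) q +
        (cacheAfter C (h.map Prod.fst) (fwzRun k C bit h)).card := by
  induction h generalizing C D bit es with
  | nil => simp [fwzRun, faults, cacheAfter]
  | cons a h ih =>
    obtain ⟨p, b⟩ := a
    cases es with
    | nil => exact hD.elim
    | cons E es =>
      obtain ⟨hD1, hD2⟩ := hD
      set F := fwzEvict k C bit p with hF
      have h1 := ih (serve C p F) (serve D p E) (Function.update bit p b) es
        (card_serve_fwzEvict bit p hk hC) hD2
      have hpay := card_fwzEvict_le_sum_pageCharge bit ((h.map Prod.fst).zip es) hC hD1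
      dsimp only at hpay
      have hsub : F ⊆ C := fwzEvict_subset k C bit p
      have hemp : p ∈ C → F = ∅ := fun hp => by rw [hF, fwzEvict, if_pos (Or.inl hp)]
      simp only [List.map_cons, fwzRun, faults, cacheAfter, List.zip_cons_cons, discardBits,
        asgCost_cons, ← hF]
      rw [← hF] at hpay
      generalize (h.map Prod.fst).zip es = l at *
      have h2 : ∑ q ∈ serve C p F, pageCharge k (serve D p E) (Function.update bit p b) l q ≤
          b.toNat + k * (evictedBeforeNext p l).toNat * (1 - b.toNat) +
            ∑ q ∈ C \ F, pageCharge k D bit ((p, E) :: l) q := by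
        rw [serve_eq_insert_erase, Finset.sum_insert (by simp), pageCharge_serve_self]
        refine Nat.add_le_add_left ?_ _
        rw [Finset.sum_congr rfl fun q hq =>
          pageCharge_serve_of_ne k D E bit l b (Finset.ne_of_mem_erase hq)]
        exact Finset.sum_le_sum_of_subset (Finset.erase_subset _ _)
      have h3 := Finset.sum_sdiff (f := pageCharge k D bit ((p, E) :: l)) hsub
      have hcard := Finset.card_sdiff_add_card_eq_card hsub
      have h4 : (serve C p F).card = (C \ F).card + if p ∈ C then 0 else 1 :=
        card_serve_of_mem_imp hemp
      omega

/-! ### Comparing the final caches -/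

theorem card_cacheAfter_le {k : ℕ} (r : List U) (es : List (Finset U)) (C : Finset U)
    (hC : C.card ≤ k) (h : PagingFeasible k C r es) : (cacheAfter C r es).card ≤ k := by
  induction r generalizing C es with
  | nil => simpa [cacheAfter] using hC
  | cons p r ih =>
    cases es with
    | nil => exact h.elim
    | cons E es => exact ih es _ h.1 h.2

/-- The cache of LFD either is full or contains that of FwZ. -/
theorem card_cacheAfter_fwzRun_le {k : ℕ} (hk : 1 ≤ k) (h : List (U × Bool)) (C D : Finset U)
    (bit : U → Bool) (hC : C.card ≤ k) (hD : D.card ≤ k) (hCD : D.card = k ∨ C ⊆ D) :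
    (cacheAfter C (h.map Prod.fst) (fwzRun k C bit h)).card ≤
      (cacheAfter D (h.map Prod.fst) (lfdRun k D (h.map Prod.fst))).card := by
  induction h generalizing C D bit with
  | nil =>
    simp only [List.map_nil, cacheAfter]
    rcases hCD with h | h
    · exact hC.trans h.ge
    · exact Finset.card_le_card h
  | cons a h ih =>
    obtain ⟨p, b⟩ := a
    have hD' := card_serve_lfdEvict p (h.map Prod.fst) hk hD
    refine ih _ _ _ (card_serve_fwzEvict bit p hk hC) hD' ?_
    by_cases hp : p ∈ D ∨ D.card < k
    · rw [lfdEvict_of_mem_or_lt _ hp, serve, serve, Finset.sdiff_empty] at *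
      rcases hCD with hCD | hCD
      · exact Or.inl (hD'.antisymm (hCD.ge.trans (Finset.card_le_card (Finset.subset_insert _ _))))
      · exact Or.inr (Finset.insert_subset_insert p (Finset.sdiff_subset.trans hCD))
    · left
      obtain ⟨q, hq, hE, -⟩ := exists_lfdEvict_eq_singleton (h.map Prod.fst) hk hp
      push Not at hp
      rw [hE, serve, Finset.sdiff_singleton_eq_erase,
        Finset.card_insert_of_notMem (by simp [hp.1]), Finset.card_erase_add_one hq]
      omega

/-! ### Bounds on instances -/

theorem sum_lfdBits_add_card (k : ℕ) (r : List U) :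
    ((lfdBits k r).map Bool.toNat).sum + (cacheAfter ∅ r (lfdRun k ∅ r)).card =
      faults ∅ r (lfdRun k ∅ r) := by
  simpa using! sum_discardBits_lfdRun_add_card k r ∅

theorem faults_fwzRun_le_asgCost_add_cacheAfter {k : ℕ} (hk : 1 ≤ k) (r : List U) (y : List Bool)
    (hy : y.length = r.length) :
    faults ∅ r (fwzRun k ∅ (fun _ => false) (r.zip y)) ≤
      asgCost k (lfdBits k r) y +
        (cacheAfter ∅ r (fwzRun k ∅ (fun _ => false) (r.zip y))).card := by
  have h := faults_fwzRun_add_card_le hk (r.zip y) ∅ ∅ (fun _ => false) (lfdRun k ∅ r) (by simp)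
    (by rw [List.map_fst_zip hy.ge]; exact lfdRun_feasible hk r ∅ (by simp))
  rw [List.map_fst_zip hy.ge, List.map_snd_zip hy.le] at h
  simpa using! h

theorem faults_fwzRun_le_asgCost_add {k : ℕ} (hk : 1 ≤ k) (r : List U) (y : List Bool)
    (hy : y.length = r.length) :
    faults ∅ r (fwzRun k ∅ (fun _ => false) (r.zip y)) ≤ asgCost k (lfdBits k r) y + k := by
  have h := fwzRun_feasible hk (r.zip y) ∅ (fun _ => false) (by simp)
  rw [List.map_fst_zip hy.ge] at h
  exact (faults_fwzRun_le_asgCost_add_cacheAfter hk r y hy).trans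
    (Nat.add_le_add_left (card_cacheAfter_le r _ ∅ (by simp) h) _)

theorem faults_fwzRun_add_sum_lfdBits_le {k : ℕ} (hk : 1 ≤ k) (r : List U) (y : List Bool)
    (hy : y.length = r.length) :
    faults ∅ r (fwzRun k ∅ (fun _ => false) (r.zip y)) + ((lfdBits k r).map Bool.toNat).sum ≤
      asgCost k (lfdBits k r) y + faults ∅ r (lfdRun k ∅ r) := by
  have h1 := faults_fwzRun_le_asgCost_add_cacheAfter hk r y hy
  have h2 := card_cacheAfter_fwzRun_le hk (r.zip y) ∅ ∅ (fun _ => false) (by simp) (by simp)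
    (Or.inr subset_rfl)
  have h3 := sum_lfdBits_add_card k r
  rw [List.map_fst_zip hy.ge] at h2
  omega

/-- LFD is no worse than the optimum. The set of costs is nonempty, so that its infimum is
attained by a feasible solution. -/
theorem faults_lfdRun_le_opt {k : ℕ} (hk : 1 ≤ k) (I : (Paging U k).Instance) :
    faults (U := U) ∅ I.r (lfdRun (U := U) k ∅ I.r) ≤ I.opt := by
  have hne : {c | ∃ y : List (Finset U), y.length = I.r.length ∧
      PagingFeasible (U := U) k ∅ I.r y ∧ faults (U := U) ∅ I.r y = c}.Nonempty :=
    ⟨_, lfdRun (U := U) k ∅ I.r, length_lfdRun (U := U) k I.r ∅,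
      lfdRun_feasible (U := U) hk I.r ∅ (by simp), rfl⟩
  obtain ⟨y, -, hy, hc⟩ := Nat.sInf_mem hne
  exact (faults_lfdRun_le (U := U) hk I.r y hy).trans hc.le

theorem cost_FwZ_le {k : ℕ} (hk : 1 ≤ k) (I : (Paging U k).Instance) :
    ((FwZ U k hk).cost I : ℝ) ≤
      (I.opt : ℝ) + ((k : ℝ) - 1) * (mu0 I.x I.xhat : ℝ) + (mu1 I.x I.xhat : ℝ) := by
  have hx : I.x = lfdBits (U := U) k I.r := I.encodes
  have hcost : (FwZ U k hk).cost I =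
      faults (U := U) ∅ I.r (fwzRun (U := U) k ∅ (fun _ => false) (List.zip I.r I.xhat)) :=
    congrArg (faults (U := U) ∅ I.r) (outputs_fwzAct (U := U) k (List.zip I.r I.xhat))
  have h1 : (FwZ U k hk).cost I + (I.x.map Bool.toNat).sum ≤ asgCost k I.x I.xhat + I.opt := by
    rw [hcost, hx]
    exact (faults_fwzRun_add_sum_lfdBits_le (U := U) hk I.r I.xhat I.length_xhat).trans
      (Nat.add_le_add_left (faults_lfdRun_le_opt hk I) _)
  have h2 : ((FwZ U k hk).cost I : ℝ) + ((I.x.map Bool.toNat).sum : ℕ) ≤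
      (asgCost k I.x I.xhat : ℝ) + I.opt := by
    exact_mod_cast h1
  have h3 := asgCost_eq k I.x I.xhat (I.length_x.trans I.length_xhat.symm)
  linarith

/-! ### The reduction to string guessing -/

/-- The string guessing instance with the same true and predicted bits as a paging instance. -/
def promptInstance {k : ℕ} (t : ℕ) (I : (Paging U k).Instance) : (ASG t).Instance where
  x := I.x
  xhat := I.xhat
  r := List.map (fun _ => ()) I.r
  length_x := I.length_x.trans (List.length_map (fun _ => ())).symm
  length_xhat := I.length_xhat.trans (List.length_map (fun _ => ())).symm
  encodes := trivial

theorem opt_promptInstance_le {k : ℕ} (hk : 1 ≤ k) (I : (Paging U k).Instance) :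
    (promptInstance k I).opt ≤ I.opt := by
  have hx : I.x = lfdBits (U := U) k I.r := I.encodes
  have h1 : (promptInstance k I).opt ≤ (I.x.map Bool.toNat).sum :=
    Nat.sInf_le ⟨I.x, (promptInstance k I).length_x, trivial, asgCost_self k I.x⟩
  have h2 : (I.x.map Bool.toNat).sum ≤ faults (U := U) ∅ I.r (lfdRun (U := U) k ∅ I.r) := by
    rw [hx]
    exact (Nat.le_add_right _ _).trans (sum_lfdBits_add_card (U := U) k I.r).le
  exact h1.trans (h2.trans (faults_lfdRun_le_opt hk I))

theorem withGuesses_zip {V : Type*} (g : List (Unit × Bool) → Bool) (r : List V) (y : List Bool)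
    (hy : y.length = r.length) :
    withGuesses g (r.zip y) = r.zip (outputs g ((r.map fun _ => ()).zip y)) := by
  rw [withGuesses, List.map_fst_zip hy.ge, List.zip_map_left]
  rfl

theorem cost_fwzWithGuesses_le {k : ℕ} (hk : 1 ≤ k) (A : (ASG k).Algorithm)
    (I : (Paging U k).Instance) :
    (fwzWithGuesses U k hk A).cost I ≤ A.cost (promptInstance k I) + k := by
  have hx : I.x = lfdBits (U := U) k I.r := I.encodes
  let y : List Bool := A.solution (promptInstance k I)
  have hy : y.length = I.r.length := by
    refine (length_outputs _ _).trans ?_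
    rw [List.length_zip, ← (promptInstance k I).length_x, (promptInstance k I).length_xhat,
      ← (promptInstance k I).length_x, min_self]
    exact I.length_x
  have hcost : (fwzWithGuesses U k hk A).cost I =
      faults (U := U) ∅ I.r (fwzRun (U := U) k ∅ (fun _ => false) (List.zip I.r y)) :=
    congrArg (faults (U := U) ∅ I.r)
      ((outputs_fwzAct_withGuesses (U := U) k A.act (List.zip I.r I.xhat)).trans
        (congrArg (fwzRun (U := U) k ∅ fun _ => false)
          (withGuesses_zip (V := U) A.act I.r I.xhat I.length_xhat)))
  have hcostA : A.cost (promptInstance k I) = asgCost k I.x y := rfl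
  rw [hcost, hcostA, hx]
  exact faults_fwzRun_le_asgCost_add (U := U) hk I.r y hy

end Caches

theorem mainTheorem4 {U : Type*} [Fintype U] [LinearOrder U] (t : ℕ) (ht : 1 ≤ t)
    (hN : t < Fintype.card U) :
    Paging U t ∈ ComplexityClass t mu0 mu1 ∧
    (∃ instMap : (ASG t).Algorithm → (Paging U t).Instance → (ASG t).Instance,
      OnlineProblem.IsStrictOnlineReduction mu0 mu1 mu0 mu1 (fwzWithGuesses U t ht) instMap) ∧
    (∀ I : (Paging U t).Instance,
      ((FwZ U t ht).cost I : ℝ) ≤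
        (I.opt : ℝ) + ((t : ℝ) - 1) * (mu0 I.x I.xhat : ℝ) + (mu1 I.x I.xhat : ℝ)) := by
  refine ⟨?_, ⟨fun _ => promptInstance t, t, fun I A => ⟨?_, opt_promptInstance_le ht I, le_rfl,
    le_rfl⟩⟩, cost_FwZ_le ht⟩
  · rintro α β γ ⟨A, κ, hA⟩
    refine ⟨fwzWithGuesses U t ht A, κ + t, fun I => ?_⟩
    have h1 : ((fwzWithGuesses U t ht A).cost I : ℝ) ≤ A.cost (promptInstance t I) + t := by
      exact_mod_cast cost_fwzWithGuesses_le ht A I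
    have h2 : (A.cost (promptInstance t I) : ℝ) ≤ α I.x I.xhat * ((promptInstance t I).opt : ℝ) +
        β I.x I.xhat * (mu0 I.x I.xhat : ℝ) + γ I.x I.xhat * (mu1 I.x I.xhat : ℝ) + κ :=
      hA (promptInstance t I)
    have h3 : (α I.x I.xhat : ℝ) * ((promptInstance t I).opt : ℝ) ≤ α I.x I.xhat * (I.opt : ℝ) :=
      mul_le_mul_of_nonneg_left (by exact_mod_cast opt_promptInstance_le ht I) (NNReal.coe_nonneg _)
    linarith
  · exact_mod_cast cost_fwzWithGuesses_le ht A I
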